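/- For a finite simple graph $G$ with adjacency matrix $A$ let $U(t)=\exp(itA)$, $t\in\mathbb R$. There is pretty good state transfer (PGST) between two distinct vertices $a,b$ of $G$ if there is a sequence of real numbers $\tau_m$ with $\lim_{m\to\infty}|U(\tau_m)_{a,b}|=1$; a vertex is involved in PGST if there is PGST between it and some other vertex. The 2-fold blow-up $\overset{2}{\uplus}G$ of $G=(V,E)$ is the graph on $\mathbb Z_2\times V$ in which $(i,a)$ and $(j,b)$ are adjacent if and only if $a$ and $b$ are adjacent in $G$. For integers $k,\ell\ge 1$ the double star $S_{k,\ell}$ is the tree obtained from an edge $uv$ by attaching $k$ pendent vertices to $u$ and $\ell$ pendent vertices to $v$; $N(\cdot)$ denotes neighbourhoods in $S_{k,\ell}$. **Theorem.** Let $k,\ell\ge 1$. The following hold in $\overset{2}{\uplus}S_{k,\ell}$. 1. If $k\ge 2$, then for every $w\in N(u)\setminus\{v\}$ and every $j\in\mathbb Z_2$ the vertex $(j,w)$ is not involved in PGST. 2. If $k=1$, then there is PGST between $(0,u)$ and $(1,u)$, between $(0,v)$ and $(1,v)$, and between $(0,w)$ and $(1,w)$ for $w\in N(u)\setminus\{v\}$.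 Further, for every $x\in N(v)\setminus\{u\}$ there is PGST between $(0,x)$ and $(1,x)$ if and only if $\ell=1$. 3. If $k=\ell$, then there is PGST between $(0,u)$ and $(1,u)$ if and only if $4k+1$ is not a perfect square. 4. If $k\ne\ell$ and the positive eigenvalues of the adjacency matrix of $S_{k,\ell}$ are linearly independent over $\mathbb Q$, then there is PGST between $(0,u)$ and $(1,u)$. -/

import Mathlib

open Filter Topology

/-- The transition matrix `U(t) = exp(i t A)` of the continuous-time quantum walk on `G`, where `A`
is the adjacency matrix of `G`. -/
noncomputable def transitionMatrix {V : Type*} [Fintype V] [DecidableEq V]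
    (G : SimpleGraph V) (t : ℝ) : Matrix V V ℂ :=
  open Classical in NormedSpace.exp ((Complex.I * (t : ℂ)) • G.adjMatrix ℂ)

/-- `G` exhibits pretty good state transfer between `a` and `b`: there are real times `τ m` with
`|U(τ m)_{a,b}| → 1`. -/
def HasPGST {V : Type*} [Fintype V] [DecidableEq V] (G : SimpleGraph V) (a b : V) : Prop :=
  ∃ τ : ℕ → ℝ, Tendsto (fun m => ‖transitionMatrix G (τ m) a b‖) atTop (𝓝 1)

/-- `a` is involved in pretty good state transfer in `G`, i.e. there is pretty good state transfer
between `a` and some other vertex. -/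
def InvolvedInPGST {V : Type*} [Fintype V] [DecidableEq V] (G : SimpleGraph V) (a : V) : Prop :=
  ∃ b : V, b ≠ a ∧ HasPGST G a b

/-- The blow-up of `n` copies of `G`: the vertex set is `ℤ_n × V`, and `(l, a)` and `(m, b)` are
adjacent iff `a` and `b` are adjacent in `G`. -/
def blowUp {V : Type*} (n : ℕ) (G : SimpleGraph V) : SimpleGraph (ZMod n × V) where
  Adj p q := G.Adj p.2 q.2
  symm := ⟨fun _ _ h => G.adj_symm h⟩
  loopless := ⟨fun _ h => G.irrefl h⟩

/-- The vertices of the double star `S_{k,ℓ}`: the left summand holds the centre `u` (as `none`) and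
its `k` leaves, the right summand holds the centre `v` (as `none`) and its `ℓ` leaves. -/
abbrev DoubleStarVertex (k l : ℕ) : Type := Option (Fin k) ⊕ Option (Fin l)

/-- The centre `u` of the double star `S_{k,ℓ}`, to which `k` leaves are attached. -/
def DoubleStarVertex.u (k l : ℕ) : DoubleStarVertex k l := Sum.inl none

/-- The centre `v` of the double star `S_{k,ℓ}`, to which `ℓ` leaves are attached. -/
def DoubleStarVertex.v (k l : ℕ) : DoubleStarVertex k l := Sum.inr none

/-- The double star `S_{k,ℓ}`: `k` pendent vertices are attached to one vertex `u` of the complete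
graph on `{u, v}`, and `ℓ` pendent vertices to the other vertex `v`. -/
def doubleStar (k l : ℕ) : SimpleGraph (DoubleStarVertex k l) :=
  SimpleGraph.fromRel fun a b =>
    (a = DoubleStarVertex.u k l ∧ b = DoubleStarVertex.v k l) ∨
    (a = DoubleStarVertex.u k l ∧ ∃ i : Fin k, b = Sum.inl (some i)) ∨
    (a = DoubleStarVertex.v k l ∧ ∃ j : Fin l, b = Sum.inr (some j))

/-- The set of (distinct) eigenvalues of the adjacency matrix of `G`. -/
def graphEigenvalues {V : Type*} [Fintype V] [DecidableEq V] (G : SimpleGraph V) : Set ℝ :=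
  open Classical in {x | Module.End.HasEigenvalue (Matrix.toLin' (G.adjMatrix ℝ)) x}

open Matrix

/-! The vertices `(0, x)` and `(1, x)` of the blow-up are twins, so the difference of their
indicators lies in the kernel of the adjacency matrix and is fixed by the walk. Hence PGST from `(0,
x)` can only reach `(1, x)`, with phase tending to -1, and it occurs if the walk sends the lift of
the indicator of `x` to its negative in the limit. A leaf with a sibling leaf has further twins in
the blow-up, which excludes PGST. Lifting doubles eigenvalues. The nonzero eigenvalues of the double
star are `±θ₁`, `±θ₂` with `θ₁² + θ₂² = k + l + 1` and `θ₁²θ₂² = kl`. The indicators of `u`, `v` and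
a lone leaf have no kernel component, so it suffices to bring both phases `exp (2iτθ)` near -1,
which is possible when `θ₂ / θ₁` is irrational (`exists_tendsto_exp_neg_one`). A rational ratio
would make `(k - l)² + 2(k + l) + 1` a square; this number is `l² + 4` for `k = 1` and `4k + 1` for
`k = l`. If `4k + 1` is a square, an integer relation between eigenvalues obstructs PGST. -/

/-! ### The walk on eigenvectors and along PGST sequences. -/

open Classical in
theorem transitionMatrix_mulVec_of_eigenvector {V : Type*} [Fintype V] [DecidableEq V]
    (G : SimpleGraph V) {x : V → ℂ} {θ : ℂ} (h : G.adjMatrix ℂ *ᵥ x = θ • x) (t : ℝ) :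
    transitionMatrix G t *ᵥ x = Complex.exp (Complex.I * t * θ) • x := by
  let _ : NormedRing (Matrix V V ℂ) := Matrix.linftyOpNormedRing
  let _ : NormedAlgebra ℂ (Matrix V V ℂ) := Matrix.linftyOpNormedAlgebra
  have hpow : ∀ n : ℕ, ((Complex.I * (t : ℂ)) • G.adjMatrix ℂ) ^ n *ᵥ x
      = (Complex.I * t * θ) ^ n • x := by
    intro n
    induction n with
    | zero => simp
    | succ n ih =>
      rw [pow_succ, ← mulVec_mulVec, smul_mulVec, h, mulVec_smul, mulVec_smul, ih, smul_smul,
        smul_smul, pow_succ]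
      congr 1
      ring
  have h1 := NormedSpace.exp_series_hasSum_exp' (𝕂 := ℂ) ((Complex.I * (t : ℂ)) • G.adjMatrix ℂ)
  have h2 := NormedSpace.exp_series_hasSum_exp' (𝕂 := ℂ) (Complex.I * t * θ)
  let φ : Matrix V V ℂ →ₗ[ℂ] (V → ℂ) := (Matrix.mulVecBilin ℂ ℂ).flip x
  have h3 := h1.mapL (LinearMap.toContinuousLinearMap φ)
  have h4 := h2.smul_const x
  rw [← Complex.exp_eq_exp_ℂ] at h4
  have h5 : ∀ n : ℕ, φ ((n.factorial⁻¹ : ℂ) • ((Complex.I * (t : ℂ)) • G.adjMatrix ℂ) ^ n)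
      = ((n.factorial⁻¹ : ℂ) • (Complex.I * t * θ) ^ n) • x := by
    intro n
    rw [map_smul, smul_assoc, ← hpow n]
    rfl
  exact h3.unique ((funext h5) ▸ h4)

theorem transitionMatrix_mem_unitaryGroup {V : Type*} [Fintype V] [DecidableEq V]
    (G : SimpleGraph V) (t : ℝ) : transitionMatrix G t ∈ Matrix.unitaryGroup V ℂ := by
  classical
  rw [Matrix.mem_unitaryGroup_iff, transitionMatrix, star_eq_conjTranspose,
    ← Matrix.exp_conjTranspose]
  have : ((Complex.I * (t : ℂ)) • G.adjMatrix ℂ)ᴴ = -((Complex.I * (t : ℂ)) • G.adjMatrix ℂ) := by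
    ext i j
    by_cases hij : G.Adj i j <;> simp [SimpleGraph.adjMatrix_apply, G.adj_comm j i, hij]
  rw [this, Matrix.exp_neg, Matrix.mul_nonsing_inv]
  exact (Matrix.isUnit_iff_isUnit_det _).mp (Matrix.isUnit_exp _)

theorem sum_norm_sq_transitionMatrix {V : Type*} [Fintype V] [DecidableEq V]
    (G : SimpleGraph V) (t : ℝ) (a : V) : ∑ b, ‖transitionMatrix G t a b‖ ^ 2 = 1 := by
  have h := congrFun (congrFun
    ((Matrix.mem_unitaryGroup_iff).mp (transitionMatrix_mem_unitaryGroup G t)) a) a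
  rw [Matrix.mul_apply, Matrix.one_apply_eq] at h
  simp only [star_apply, RCLike.star_def, Complex.mul_conj'] at h
  exact_mod_cast h

theorem tendsto_transitionMatrix_zero {V : Type*} [Fintype V] [DecidableEq V]
    {G : SimpleGraph V} {τ : ℕ → ℝ} {a b : V}
    (h : Tendsto (fun m => ‖transitionMatrix G (τ m) a b‖) atTop (𝓝 1)) {c : V} (hc : c ≠ b) :
    Tendsto (fun m => transitionMatrix G (τ m) a c) atTop (𝓝 0) := by
  rw [tendsto_zero_iff_norm_tendsto_zero]
  have h1 : Tendsto (fun m => Real.sqrt (1 - ‖transitionMatrix G (τ m) a b‖ ^ 2)) atTop (𝓝 0) := by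
    simpa using ((h.pow 2).const_sub 1).sqrt
  refine squeeze_zero (fun _ => norm_nonneg _) (fun m => ?_) h1
  refine Real.le_sqrt_of_sq_le ?_
  have h2 := sum_norm_sq_transitionMatrix G (τ m) a
  have h3 : ∑ x ∈ {c, b}, ‖transitionMatrix G (τ m) a x‖ ^ 2 ≤ 1 := by
    rw [← h2]
    exact Finset.sum_le_sum_of_subset_of_nonneg (Finset.subset_univ _) (fun _ _ _ => by positivity)
  rw [Finset.sum_pair hc] at h3
  linarith

-- In row `a` only the entry at `b` survives in the limit, so the eigenvector equation read at `a`
-- compares `x a` with `x b` alone.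
open Classical in
theorem tendsto_of_eigenvector {V : Type*} [Fintype V] [DecidableEq V]
    {G : SimpleGraph V} {τ : ℕ → ℝ} {a b : V}
    (h : Tendsto (fun m => ‖transitionMatrix G (τ m) a b‖) atTop (𝓝 1))
    {x : V → ℂ} {θ : ℂ} (hx : G.adjMatrix ℂ *ᵥ x = θ • x) :
    Tendsto (fun m => Complex.exp (Complex.I * τ m * θ) * x a - transitionMatrix G (τ m) a b * x b)
      atTop (𝓝 0) := by
  have h1 : ∀ m, Complex.exp (Complex.I * τ m * θ) * x a - transitionMatrix G (τ m) a b * x b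
      = ∑ c ∈ Finset.univ.erase b, transitionMatrix G (τ m) a c * x c := by
    intro m
    have := congrFun (transitionMatrix_mulVec_of_eigenvector G hx (τ m)) a
    rw [Pi.smul_apply, smul_eq_mul] at this
    rw [← this, mulVec, dotProduct, ← Finset.add_sum_erase _ _ (Finset.mem_univ b)]
    ring
  simp only [h1]
  rw [← Finset.sum_const_zero (s := Finset.univ.erase b) (M := ℂ)]
  refine tendsto_finsetSum _ fun c hc => ?_
  simpa using (tendsto_transitionMatrix_zero h (Finset.ne_of_mem_erase hc)).mul_const (x c)

/-! ### Twins and blow-ups. -/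

open Classical in
theorem blowUp_mulVec_comp_snd {V : Type*} [Fintype V] (G : SimpleGraph V) (y : V → ℂ) :
    (blowUp 2 G).adjMatrix ℂ *ᵥ (y ∘ Prod.snd)
      = (2 : ℂ) • ((G.adjMatrix ℂ *ᵥ y) ∘ (Prod.snd : ZMod 2 × V → V)) := by
  ext p
  have h : ∀ q, (blowUp 2 G).Adj p q ↔ G.Adj p.2 q.2 := fun _ => Iff.rfl
  simp only [mulVec, dotProduct, Fintype.sum_prod_type, SimpleGraph.adjMatrix_apply, h]
  simp [SimpleGraph.neighborFinset_eq_filter, Finset.sum_filter]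

open Classical in
theorem adjMatrix_mulVec_single_sub_single {V : Type*} [Fintype V] [DecidableEq V]
    {G : SimpleGraph V} {a b : V} (h : ∀ c, G.Adj c a ↔ G.Adj c b) :
    G.adjMatrix ℂ *ᵥ (Pi.single a 1 - Pi.single b 1) = 0 := by
  ext c
  simp [h c]

/-- Apply `tendsto_of_eigenvector` to the kernel vector `e_a - e_c`: its value 1 at `a` must be
balanced by its value at `b`, which is zero unless `b = c`. -/
theorem tendsto_neg_one_of_twin {V : Type*} [Fintype V] [DecidableEq V]
    {G : SimpleGraph V} {τ : ℕ → ℝ} {a b c : V}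
    (h : Tendsto (fun m => ‖transitionMatrix G (τ m) a b‖) atTop (𝓝 1)) (hab : b ≠ a)
    (hac : c ≠ a) (htw : ∀ d, G.Adj d a ↔ G.Adj d c) :
    b = c ∧ Tendsto (fun m => transitionMatrix G (τ m) a b) atTop (𝓝 (-1)) := by
  classical
  have h1 := tendsto_of_eigenvector h (θ := 0) (x := Pi.single a 1 - Pi.single c 1)
    (by rw [adjMatrix_mulVec_single_sub_single htw, zero_smul])
  by_cases hbc : b = c
  · subst hbc
    refine ⟨rfl, ?_⟩
    simp [hab, hab.symm] at h1
    simpa using h1.sub_const 1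
  · simp [hab, hac.symm, hbc] at h1

theorem not_involvedInPGST_blowUp_of_twin {V : Type*} [Fintype V] [DecidableEq V]
    {G : SimpleGraph V} {a b : V} (hab : b ≠ a) (htw : ∀ d, G.Adj d a ↔ G.Adj d b)
    (j : ZMod 2) : ¬ InvolvedInPGST (blowUp 2 G) (j, a) := by
  rintro ⟨q, hq, τ, h⟩
  have h1 := (tendsto_neg_one_of_twin h hq (c := (j + 1, a)) (by simp) (fun d => Iff.rfl)).1
  have h2 := (tendsto_neg_one_of_twin h hq (c := (j, b)) (by simp [hab]) (fun d => htw d.2)).1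
  rw [h1] at h2
  simp at h2

/-- A vector of `G` killed by `(A² - θ₁²)(A² - θ₂²)` is negated in the limit by the blow-up's walk,
along times at which both phases `exp (2 i t θ)` tend to `-1`. -/
theorem tendsto_transitionMatrix_mulVec_neg {V : Type*} [Fintype V] [DecidableEq V]
    (G : SimpleGraph V) {A : (V → ℂ) →ₗ[ℂ] (V → ℂ)}
    (hA : open Classical in A = Matrix.toLin' (G.adjMatrix ℂ)) {θ₁ θ₂ : ℝ}
    (h₁ : 0 < θ₁) (h₂ : 0 < θ₂) (hne : θ₁ ^ 2 ≠ θ₂ ^ 2) {s : ℕ → ℝ}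
    (hs₁ : Tendsto (fun m => Complex.exp (Complex.I * s m * θ₁)) atTop (𝓝 (-1)))
    (hs₂ : Tendsto (fun m => Complex.exp (Complex.I * s m * θ₂)) atTop (𝓝 (-1)))
    {y : V → ℂ} (hy : A (A (A (A y))) = ((θ₁ : ℂ) ^ 2 + (θ₂ : ℂ) ^ 2) • A (A y)
      - ((θ₁ : ℂ) ^ 2 * (θ₂ : ℂ) ^ 2) • y) :
    Tendsto (fun m => transitionMatrix (blowUp 2 G) (s m / 2) *ᵥ (y ∘ Prod.snd)) atTop
      (𝓝 (-(y ∘ Prod.snd))) := by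
  classical
  let S : Submodule ℂ (V → ℂ) :=
    { carrier := {y | Tendsto (fun m => transitionMatrix (blowUp 2 G) (s m / 2) *ᵥ (y ∘ Prod.snd))
        atTop (𝓝 (-(y ∘ Prod.snd)))}
      add_mem' := by
        intro a b ha hb
        have := Tendsto.add ha hb
        simp only [← mulVec_add, ← neg_add] at this
        exact this
      zero_mem' := by
        have : (0 : V → ℂ) ∘ (Prod.snd : ZMod 2 × V → V) = 0 := rfl
        simp [this]
      smul_mem' := by
        intro c a ha
        have := Tendsto.const_smul ha c
        simp only [← mulVec_smul] at this
        rw [smul_neg] at this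
        exact this }
  have key : ∀ (θ : ℂ) (z : V → ℂ), A z = θ • z →
      Tendsto (fun m => Complex.exp (Complex.I * s m * θ)) atTop (𝓝 (-1)) → z ∈ S := by
    intro θ z hz hθ
    have hB : (blowUp 2 G).adjMatrix ℂ *ᵥ (z ∘ Prod.snd) = (2 * θ) • (z ∘ Prod.snd) := by
      rw [blowUp_mulVec_comp_snd]
      rw [hA, toLin'_apply] at hz
      rw [mul_smul, hz]
      rfl
    change Tendsto _ _ _
    simp only [transitionMatrix_mulVec_of_eigenvector _ hB]
    have := hθ.smul_const (z ∘ (Prod.snd : ZMod 2 × V → V))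
    rw [neg_one_smul] at this
    refine this.congr fun m => ?_
    congr 2
    push_cast
    ring
  have key2 : ∀ (θ : ℝ) (z : V → ℂ), 0 < θ → A (A z) = ((θ : ℂ) ^ 2) • z →
      Tendsto (fun m => Complex.exp (Complex.I * s m * θ)) atTop (𝓝 (-1)) → z ∈ S := by
    intro θ z h0 hz hθ
    have hθ' : Tendsto (fun m => Complex.exp (Complex.I * s m * (-θ))) atTop (𝓝 (-1)) := by
      have := hθ.inv₀ (by norm_num)
      rw [inv_neg, inv_one] at this
      refine this.congr fun m => ?_
      rw [← Complex.exp_neg]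
      congr 1
      ring
    -- `θz ± Az` are eigenvectors for `±θ`, and their sum is `2θz`.
    have a1 : (θ : ℂ) • z + A z ∈ S := key θ _ (by rw [map_add, map_smul, hz]; module) hθ
    have a2 : (θ : ℂ) • z - A z ∈ S := key (-θ) _ (by rw [map_sub, map_smul, hz]; module) hθ'
    have h0' : (θ : ℂ) ≠ 0 := by exact_mod_cast h0.ne'
    have : z = (2 * (θ : ℂ))⁻¹ • (((θ : ℂ) • z + A z) + ((θ : ℂ) • z - A z)) := by
      rw [show ((θ : ℂ) • z + A z) + ((θ : ℂ) • z - A z) = (2 * (θ : ℂ)) • z by module,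
        inv_smul_smul₀ (mul_ne_zero two_ne_zero h0')]
    rw [this]
    exact S.smul_mem _ (S.add_mem a1 a2)
  -- Each factor of `(A² - θ₁²)(A² - θ₂²)` maps `y` into the kernel of the other.
  have b1 : A (A y) - ((θ₂ : ℂ) ^ 2) • y ∈ S :=
    key2 θ₁ _ h₁ (by simp only [map_sub, map_smul, hy]; module) hs₁
  have b2 : A (A y) - ((θ₁ : ℂ) ^ 2) • y ∈ S :=
    key2 θ₂ _ h₂ (by simp only [map_sub, map_smul, hy]; module) hs₂
  have hne' : (θ₁ : ℂ) ^ 2 - (θ₂ : ℂ) ^ 2 ≠ 0 := sub_ne_zero.mpr (by exact_mod_cast hne)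
  have : y = ((θ₁ : ℂ) ^ 2 - (θ₂ : ℂ) ^ 2)⁻¹ •
      ((A (A y) - ((θ₂ : ℂ) ^ 2) • y) - (A (A y) - ((θ₁ : ℂ) ^ 2) • y)) := by
    rw [show ((A (A y) - ((θ₂ : ℂ) ^ 2) • y) - (A (A y) - ((θ₁ : ℂ) ^ 2) • y))
      = ((θ₁ : ℂ) ^ 2 - (θ₂ : ℂ) ^ 2) • y by module, inv_smul_smul₀ hne']
  have hmem : y ∈ S := by
    rw [this]
    exact S.smul_mem _ (S.sub_mem b1 b2)
  exact hmem

theorem hasPGST_blowUp_of_tendsto {V : Type*} [Fintype V] [DecidableEq V]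
    (G : SimpleGraph V) (x : V) {τ : ℕ → ℝ}
    (h : Tendsto (fun m => transitionMatrix (blowUp 2 G) (τ m) *ᵥ
      ((Pi.single x 1 : V → ℂ) ∘ Prod.snd)) atTop (𝓝 (-((Pi.single x 1 : V → ℂ) ∘ Prod.snd)))) :
    HasPGST (blowUp 2 G) (0, x) (1, x) := by
  classical
  refine ⟨τ, ?_⟩
  have hz : (blowUp 2 G).adjMatrix ℂ *ᵥ (Pi.single (0, x) 1 - Pi.single (1, x) 1)
      = (0 : ℂ) • (Pi.single (0, x) 1 - Pi.single (1, x) 1) := by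
    rw [zero_smul]
    exact adjMatrix_mulVec_single_sub_single fun c => Iff.rfl
  have hsum : (Pi.single x 1 : V → ℂ) ∘ Prod.snd
      = (Pi.single ((0 : ZMod 2), x) 1 + Pi.single (1, x) 1 : ZMod 2 × V → ℂ) := by
    ext ⟨i, y⟩
    obtain rfl | rfl : i = 0 ∨ i = 1 := by revert i; decide
    all_goals by_cases hy : y = x <;> simp [Prod.ext_iff, hy]
  have h1 : ∀ m, transitionMatrix (blowUp 2 G) (τ m) (0, x) (1, x)
      = ((transitionMatrix (blowUp 2 G) (τ m) *ᵥ ((Pi.single x 1 : V → ℂ) ∘ Prod.snd)) (0, x) - 1)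
        / 2 := by
    intro m
    have h2 := congrFun (transitionMatrix_mulVec_of_eigenvector _ hz (τ m)) (0, x)
    simp [mulVec_sub] at h2
    rw [hsum]
    simp [mulVec_add]
    linear_combination -(1 / 2 : ℂ) * h2
  have h3 := (((tendsto_pi_nhds.mp h (0, x)).sub_const 1).div_const 2).norm
  simp only [← h1] at h3
  simpa [show (-1 - 1 : ℂ) / 2 = -1 by norm_num] using h3

/-! ### Simultaneous approximation of two phases. -/

theorem exists_tendsto_exp_neg_one {θ₁ θ₂ : ℝ} (h₁ : θ₁ ≠ 0)
    (h : Irrational (θ₂ / θ₁)) : ∃ s : ℕ → ℝ,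
    Tendsto (fun m => Complex.exp (Complex.I * s m * θ₁)) atTop (𝓝 (-1)) ∧
    Tendsto (fun m => Complex.exp (Complex.I * s m * θ₂)) atTop (𝓝 (-1)) := by
  set ρ := θ₂ / θ₁ with hρ
  have hd : Dense (AddSubgroup.closure {ρ, 1} : Set ℝ) :=
    dense_addSubgroupClosure_pair_iff.mpr (by simpa using h)
  -- The target `(1 - ρ) / 2` encodes `(2n + 1)ρ + 2k ≈ 1`: at time `(2n + 1)π / θ₁` the first phase
  -- is exactly -1 and the second nearly so.
  have hex : ∀ m : ℕ, ∃ n k : ℤ, |(1 - ρ) / 2 - (n * ρ + k)| < 1 / ((m : ℝ) + 1) := by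
    intro m
    obtain ⟨z, hz, hlt⟩ := Metric.dense_iff.mp hd ((1 - ρ) / 2) (1 / ((m : ℝ) + 1)) (by positivity)
    obtain ⟨n, k, rfl⟩ := AddSubgroup.mem_closure_pair.mp hlt
    refine ⟨n, k, ?_⟩
    rw [Metric.mem_ball, dist_comm, Real.dist_eq] at hz
    simpa using hz
  choose n k hnk using hex
  have hlim : Tendsto (fun m => (1 - ρ) / 2 - (n m * ρ + k m)) atTop (𝓝 0) :=
    squeeze_zero_norm (fun m => (hnk m).le) tendsto_one_div_add_atTop_nhds_zero_nat
  refine ⟨fun m => (2 * n m + 1) * Real.pi / θ₁, ?_, ?_⟩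
  · refine tendsto_const_nhds.congr fun m => ?_
    have : Complex.I * ((2 * n m + 1) * Real.pi / θ₁ : ℝ) * θ₁
        = Real.pi * Complex.I + (n m) * (2 * Real.pi * Complex.I) := by
      have : (θ₁ : ℂ) ≠ 0 := by exact_mod_cast h₁
      push_cast
      field_simp
      ring
    rw [this, Complex.exp_add, Complex.exp_int_mul_two_pi_mul_I, Complex.exp_pi_mul_I, mul_one]
  · have h2 : ∀ m, Complex.exp (Complex.I * ((2 * n m + 1) * Real.pi / θ₁ : ℝ) * θ₂)
        = -Complex.exp (-(2 * Real.pi * Complex.I) *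
          (((1 - ρ) / 2 - (n m * ρ + k m) : ℝ) : ℂ)) := by
      intro m
      have : Complex.I * ((2 * n m + 1) * Real.pi / θ₁ : ℝ) * θ₂
        = Real.pi * Complex.I + -(2 * Real.pi * Complex.I) *
          (((1 - ρ) / 2 - (n m * ρ + k m) : ℝ) : ℂ) + ((-k m : ℤ) : ℂ) * (2 * Real.pi * Complex.I) := by
        have : (θ₁ : ℂ) ≠ 0 := by exact_mod_cast h₁
        rw [hρ]
        push_cast
        field_simp
        ring
      rw [this, Complex.exp_add, Complex.exp_add, Complex.exp_int_mul_two_pi_mul_I,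
        Complex.exp_pi_mul_I]
      ring
    simp only [h2]
    have hc : Continuous fun r : ℝ => -Complex.exp (-(2 * Real.pi * Complex.I) * (r : ℂ)) := by
      fun_prop
    have := (hc.tendsto 0).comp hlim
    simp only [Function.comp_def] at this
    simpa only [Complex.ofReal_zero, mul_zero, Complex.exp_zero] using this

/-! ### Spectrum of the double star and sufficient conditions for PGST. -/

/-- The function on the double star with values `a`, `b`, `c`, `d` on `u`, on the leaves at `u`,
on `v` and on the leaves at `v`. -/
def doubleStarVec {R : Type*} (k l : ℕ) (a b c d : R) : DoubleStarVertex k l → R :=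
  Sum.elim (fun o => o.elim a fun _ => b) (fun o => o.elim c fun _ => d)

theorem doubleStar_adj_iff {k l : ℕ} {a b : DoubleStarVertex k l} :
    (doubleStar k l).Adj a b ↔ a ≠ b ∧
      (((a = Sum.inl none ∧ b = Sum.inr none) ∨
        (a = Sum.inl none ∧ ∃ i : Fin k, b = Sum.inl (some i)) ∨
        (a = Sum.inr none ∧ ∃ j : Fin l, b = Sum.inr (some j))) ∨
      ((b = Sum.inl none ∧ a = Sum.inr none) ∨
        (b = Sum.inl none ∧ ∃ i : Fin k, a = Sum.inl (some i)) ∨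
        (b = Sum.inr none ∧ ∃ j : Fin l, a = Sum.inr (some j)))) :=
  Iff.rfl

open Classical in
theorem adjMatrix_mulVec_doubleStarVec {R : Type*} [CommRing R] (k l : ℕ) (a b c d : R) :
    (doubleStar k l).adjMatrix R *ᵥ doubleStarVec k l a b c d
      = doubleStarVec k l (k * b + c) a (l * d + a) c := by
  ext p
  simp only [mulVec, dotProduct, Fintype.sum_sum_type, Fintype.sum_option,
    SimpleGraph.adjMatrix_apply, doubleStar_adj_iff]
  rcases p with (_ | i) | (_ | j) <;> simp [doubleStarVec, add_comm]

theorem smul_doubleStarVec {R : Type*} [CommRing R] (k l : ℕ) (r a b c d : R) :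
    r • doubleStarVec k l a b c d = doubleStarVec k l (r * a) (r * b) (r * c) (r * d) := by
  ext p
  rcases p with (_ | i) | (_ | j) <;> rfl

theorem sub_doubleStarVec {R : Type*} [CommRing R] (k l : ℕ) (a b c d a' b' c' d' : R) :
    doubleStarVec k l a b c d - doubleStarVec k l a' b' c' d'
      = doubleStarVec k l (a - a') (b - b') (c - c') (d - d') := by
  ext p
  rcases p with (_ | i) | (_ | j) <;> rfl

theorem mem_graphEigenvalues_doubleStar (k l : ℕ) {θ : ℝ} (h0 : 0 < θ)
    (h : θ ^ 4 - (k + l + 1) * θ ^ 2 + k * l = 0) : θ ∈ graphEigenvalues (doubleStar k l) := by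
  classical
  have h1 : (doubleStar k l).adjMatrix ℝ *ᵥ
      doubleStarVec k l (θ ^ 2) θ (θ * (θ ^ 2 - k)) (θ ^ 2 - k)
      = θ • doubleStarVec k l (θ ^ 2) θ (θ * (θ ^ 2 - k)) (θ ^ 2 - k) := by
    rw [adjMatrix_mulVec_doubleStarVec, smul_doubleStarVec]
    congr 1
    · ring
    · ring
    · linear_combination -h
  refine Module.End.hasEigenvalue_of_hasEigenvector
    (x := doubleStarVec k l (θ ^ 2) θ (θ * (θ ^ 2 - k)) (θ ^ 2 - k)) ⟨?_, ?_⟩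
  · rw [Module.End.mem_eigenspace_iff, toLin'_apply]
    exact h1
  · intro h2
    have := congrFun h2 (Sum.inl none)
    simp [doubleStarVec, h0.ne'] at this

theorem exists_pos_roots {k l : ℕ} (hk : 1 ≤ k) (hl : 1 ≤ l) : ∃ θ₁ θ₂ : ℝ, 0 < θ₁ ∧ 0 < θ₂ ∧
    2 * θ₁ ^ 2 = k + l + 1 + √((k - l) ^ 2 + 2 * (k + l) + 1) ∧
    θ₁ ^ 2 + θ₂ ^ 2 = k + l + 1 ∧ θ₁ ^ 2 * θ₂ ^ 2 = k * l ∧ θ₁ ^ 2 ≠ θ₂ ^ 2 := by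
  have hk' : (1 : ℝ) ≤ k := by exact_mod_cast hk
  have hl' : (1 : ℝ) ≤ l := by exact_mod_cast hl
  have hpos : (0 : ℝ) < (k - l) ^ 2 + 2 * (k + l) + 1 := by positivity
  set r := √(((k : ℝ) - l) ^ 2 + 2 * (k + l) + 1) with hr
  have hr0 : 0 < r := Real.sqrt_pos.mpr hpos
  have hr2 : r ^ 2 = ((k : ℝ) - l) ^ 2 + 2 * (k + l) + 1 := Real.sq_sqrt hpos.le
  have hlt : r < k + l + 1 := by
    refine lt_of_pow_lt_pow_left₀ 2 (by positivity) ?_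
    rw [hr2]
    nlinarith
  have h1 : 0 < ((k : ℝ) + l + 1 + r) / 2 := by positivity
  have h2 : 0 < ((k : ℝ) + l + 1 - r) / 2 := by linarith
  refine ⟨√((k + l + 1 + r) / 2), √((k + l + 1 - r) / 2), Real.sqrt_pos.mpr h1,
    Real.sqrt_pos.mpr h2, ?_⟩
  rw [Real.sq_sqrt h1.le, Real.sq_sqrt h2.le]
  refine ⟨by ring, by ring, by linear_combination -hr2 / 4, fun h => ?_⟩
  linarith

theorem irrational_div_of_not_isSquare {k l : ℕ} {D : ℕ} {θ₁ θ₂ : ℝ} (h₁ : 0 < θ₁)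
    (hr : 2 * θ₁ ^ 2 = k + l + 1 + √D) (hsum : θ₁ ^ 2 + θ₂ ^ 2 = k + l + 1)
    (hD : ¬ IsSquare D) : Irrational (θ₂ / θ₁) := by
  rintro ⟨q, hq⟩
  -- With `θ₂ = qθ₁` the sum of squares gives `θ₁² = (k + l + 1) / (1 + q²)`, so `√D = 2θ₁² - (k + l
  -- + 1)` is rational.
  refine irrational_sqrt_natCast_iff.mpr hD ⟨2 * (k + l + 1) / (1 + q ^ 2) - (k + l + 1), ?_⟩
  have h2 : θ₂ = q * θ₁ := by rw [hq]; field_simp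
  have h3 : (1 + (q : ℝ) ^ 2) ≠ 0 := by positivity
  push_cast
  rw [h2] at hsum
  rw [sub_eq_iff_eq_add, div_eq_iff h3]
  linear_combination (1 + (q : ℝ) ^ 2) * hr - 2 * hsum

theorem hasPGST_blowUp_doubleStar {k l : ℕ} {x : DoubleStarVertex k l} {a b c d : ℂ}
    (hx : Pi.single x 1 = doubleStarVec k l a b c d) {θ₁ θ₂ : ℝ} (h₁ : 0 < θ₁) (h₂ : 0 < θ₂)
    (hne : θ₁ ^ 2 ≠ θ₂ ^ 2) (hsum : θ₁ ^ 2 + θ₂ ^ 2 = k + l + 1)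
    (hprod : θ₁ ^ 2 * θ₂ ^ 2 = k * l) (hirr : Irrational (θ₂ / θ₁)) :
    HasPGST (blowUp 2 (doubleStar k l)) (0, x) (1, x) := by
  classical
  obtain ⟨s, hs₁, hs₂⟩ := exists_tendsto_exp_neg_one h₁.ne' hirr
  refine hasPGST_blowUp_of_tendsto _ x
    (tendsto_transitionMatrix_mulVec_neg _ rfl h₁ h₂ hne hs₁ hs₂ ?_)
  have hs : (θ₁ : ℂ) ^ 2 + (θ₂ : ℂ) ^ 2 = k + l + 1 := by exact_mod_cast hsum
  have hp : (θ₁ : ℂ) ^ 2 * (θ₂ : ℂ) ^ 2 = k * l := by exact_mod_cast hprod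
  -- This is Cayley–Hamilton for the 4 × 4 quotient matrix acting on functions constant on each
  -- class of leaves.
  simp only [hx, hs, hp, toLin'_apply, adjMatrix_mulVec_doubleStarVec, smul_doubleStarVec,
    sub_doubleStarVec]
  congr 1 <;> ring

theorem single_u (k l : ℕ) :
    (Pi.single (DoubleStarVertex.u k l) 1 : _ → ℂ) = doubleStarVec k l 1 0 0 0 := by
  ext p
  rcases p with (_ | i) | (_ | j) <;> simp [DoubleStarVertex.u, doubleStarVec]

theorem single_v (k l : ℕ) :
    (Pi.single (DoubleStarVertex.v k l) 1 : _ → ℂ) = doubleStarVec k l 0 0 1 0 := by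
  ext p
  rcases p with (_ | i) | (_ | j) <;> simp [DoubleStarVertex.v, doubleStarVec]

theorem single_leaf_left (l : ℕ) (i : Fin 1) :
    (Pi.single (Sum.inl (some i) : DoubleStarVertex 1 l) 1 : _ → ℂ)
      = doubleStarVec 1 l 0 1 0 0 := by
  ext p
  rcases p with (_ | i) | (_ | j) <;> simp [doubleStarVec, Pi.single_apply, eq_iff_true_of_subsingleton]

theorem single_leaf_right (k : ℕ) (j : Fin 1) :
    (Pi.single (Sum.inr (some j) : DoubleStarVertex k 1) 1 : _ → ℂ)
      = doubleStarVec k 1 0 0 0 1 := by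
  ext p
  rcases p with (_ | i) | (_ | j) <;> simp [doubleStarVec, Pi.single_apply, eq_iff_true_of_subsingleton]

theorem hasPGST_blowUp_doubleStar_of_not_isSquare {k l : ℕ} (hk : 1 ≤ k) (hl : 1 ≤ l) {D : ℕ}
    (hD : (D : ℝ) = (k - l) ^ 2 + 2 * (k + l) + 1) (hsq : ¬ IsSquare D)
    {x : DoubleStarVertex k l} {a b c d : ℂ} (hx : Pi.single x 1 = doubleStarVec k l a b c d) :
    HasPGST (blowUp 2 (doubleStar k l)) (0, x) (1, x) := by
  obtain ⟨θ₁, θ₂, h₁, h₂, hr, hsum, hprod, hne⟩ := exists_pos_roots hk hl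
  rw [← hD] at hr
  exact hasPGST_blowUp_doubleStar hx h₁ h₂ hne hsum hprod
    (irrational_div_of_not_isSquare h₁ hr hsum hsq)

theorem hasPGST_blowUp_doubleStar_of_linearIndepOn {k l : ℕ} (hk : 1 ≤ k) (hl : 1 ≤ l)
    (h : LinearIndepOn ℚ (fun x : ℝ => x) {x | x ∈ graphEigenvalues (doubleStar k l) ∧ 0 < x})
    {x : DoubleStarVertex k l} {a b c d : ℂ} (hx : Pi.single x 1 = doubleStarVec k l a b c d) :
    HasPGST (blowUp 2 (doubleStar k l)) (0, x) (1, x) := by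
  obtain ⟨θ₁, θ₂, h₁, h₂, -, hsum, hprod, hne⟩ := exists_pos_roots hk hl
  refine hasPGST_blowUp_doubleStar hx h₁ h₂ hne hsum hprod ?_
  rintro ⟨q, hq⟩
  have e1 : θ₁ ∈ graphEigenvalues (doubleStar k l) :=
    mem_graphEigenvalues_doubleStar k l h₁ (by linear_combination θ₁ ^ 2 * hsum - hprod)
  have e2 : θ₂ ∈ graphEigenvalues (doubleStar k l) :=
    mem_graphEigenvalues_doubleStar k l h₂ (by linear_combination θ₂ ^ 2 * hsum - hprod)
  have hpair : LinearIndepOn ℚ (fun x : ℝ => x) {θ₁, θ₂} :=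
    h.mono (Set.insert_subset ⟨e1, h₁⟩ (Set.singleton_subset_iff.mpr ⟨e2, h₂⟩))
  rw [linearIndepOn_pair_iff _ (fun h => hne (by rw [h])) h₁.ne'] at hpair
  refine hpair q ?_
  rw [Rat.smul_def, hq]
  field_simp

/-! ### Arithmetic and the obstruction for `k = l`. -/

theorem not_isSquare_sq_add_four {l : ℕ} (hl : 1 ≤ l) : ¬ IsSquare (l ^ 2 + 4) := by
  rintro ⟨n, hn⟩
  have h1 : l < n := by nlinarith
  obtain ⟨m, rfl⟩ := Nat.exists_eq_add_of_lt h1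
  have : m = 0 := by nlinarith
  subst this
  have : 2 * l = 3 := by nlinarith
  omega

/-- If `4k + 1 = (2m + 1)²`, then `k = m(m + 1)` and the roots `m + 1`, `-m` of `θ² = θ + k` are
eigenvalues whose eigenvectors do not vanish at `u`. PGST would force both phases to -1. -/
theorem not_hasPGST_blowUp_doubleStar_u {k : ℕ} (hk : 1 ≤ k) (hsq : IsSquare (4 * k + 1)) :
    ¬ HasPGST (blowUp 2 (doubleStar k k))
      (0, DoubleStarVertex.u k k) (1, DoubleStarVertex.u k k) := by
  classical
  rintro ⟨τ, h⟩
  obtain ⟨n, hn⟩ := hsq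
  obtain ⟨m, rfl⟩ : ∃ m, n = 2 * m + 1 := by
    rcases Nat.even_or_odd' n with ⟨m, rfl | rfl⟩
    · exfalso
      have : 4 * (m * m) = 4 * k + 1 := by rw [hn]; ring
      omega
    · exact ⟨m, rfl⟩
  have hkm : k = m * (m + 1) := by nlinarith
  have hm : m ≠ 0 := by rintro rfl; omega
  have hlim := (tendsto_neg_one_of_twin h (c := (1, DoubleStarVertex.u k k)) (by simp) (by simp)
    (fun d => Iff.rfl)).2
  have key : ∀ θ : ℂ, θ ≠ 0 → θ ^ 2 = θ + k →
      Tendsto (fun j => Complex.exp (Complex.I * τ j * (2 * θ))) atTop (𝓝 (-1)) := by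
    intro θ h0 hθ
    have h1 : (blowUp 2 (doubleStar k k)).adjMatrix ℂ *ᵥ
        (doubleStarVec k k θ 1 θ 1 ∘ Prod.snd)
        = (2 * θ) • (doubleStarVec k k θ 1 θ 1 ∘ Prod.snd) := by
      rw [blowUp_mulVec_comp_snd, adjMatrix_mulVec_doubleStarVec, mul_smul]
      congr 1
      change _ = (θ • doubleStarVec k k θ 1 θ 1) ∘ Prod.snd
      rw [smul_doubleStarVec]
      congr 2 <;> first | ring1 | linear_combination -hθ
    have h2 := tendsto_of_eigenvector h h1
    have h3 : ∀ i : ZMod 2, (doubleStarVec k k θ 1 θ 1 ∘ Prod.snd) (i, DoubleStarVertex.u k k) = θ :=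
      fun _ => rfl
    simp only [h3] at h2
    have h4 := ((h2.mul_const θ⁻¹).add hlim)
    rw [zero_mul, zero_add] at h4
    refine h4.congr fun j => ?_
    field_simp
    ring
  have h1 := key (m + 1) (by exact_mod_cast m.succ_ne_zero) (by rw [hkm]; push_cast; ring)
  have h2 := key (-m) (by simpa using hm) (by rw [hkm]; push_cast; ring)
  -- Since `m(m + 1) + (m + 1)(-m) = 0`, this product is constantly 1, while its limit is `(-1)^(2m
  -- + 1)`.
  have h3 := (h1.pow m).mul (h2.pow (m + 1))
  have h4 : ∀ j, Complex.exp (Complex.I * τ j * (2 * (m + 1))) ^ m *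
      Complex.exp (Complex.I * τ j * (2 * (-m))) ^ (m + 1) = 1 := by
    intro j
    rw [← Complex.exp_nat_mul, ← Complex.exp_nat_mul, ← Complex.exp_add]
    convert Complex.exp_zero using 2
    push_cast
    ring
  simp only [h4] at h3
  have h5 := tendsto_nhds_unique tendsto_const_nhds h3
  rw [← pow_add, Odd.neg_one_pow ⟨m, by ring⟩] at h5
  norm_num at h5

/-! ### Leaves as twins, and the theorem. -/

theorem mem_neighborSet_u_diff {k l : ℕ} {w : DoubleStarVertex k l}
    (h : w ∈ (doubleStar k l).neighborSet (DoubleStarVertex.u k l) \ {DoubleStarVertex.v k l}) :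
    ∃ i, w = Sum.inl (some i) := by
  rcases w with (_ | i) | (_ | j) <;>
    simp_all [doubleStar, DoubleStarVertex.u, DoubleStarVertex.v]

theorem mem_neighborSet_v_diff {k l : ℕ} {x : DoubleStarVertex k l}
    (h : x ∈ (doubleStar k l).neighborSet (DoubleStarVertex.v k l) \ {DoubleStarVertex.u k l}) :
    ∃ j, x = Sum.inr (some j) := by
  rcases x with (_ | i) | (_ | j) <;>
    simp_all [doubleStar, DoubleStarVertex.u, DoubleStarVertex.v]

theorem adj_leaf_left_iff {k l : ℕ} (i i' : Fin k) (d : DoubleStarVertex k l) :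
    (doubleStar k l).Adj d (Sum.inl (some i)) ↔ (doubleStar k l).Adj d (Sum.inl (some i')) := by
  rcases d with (_ | _) | (_ | _) <;> simp [doubleStar, DoubleStarVertex.u, DoubleStarVertex.v]

theorem adj_leaf_right_iff {k l : ℕ} (j j' : Fin l) (d : DoubleStarVertex k l) :
    (doubleStar k l).Adj d (Sum.inr (some j)) ↔ (doubleStar k l).Adj d (Sum.inr (some j')) := by
  rcases d with (_ | _) | (_ | _) <;> simp [doubleStar, DoubleStarVertex.u, DoubleStarVertex.v]

theorem mainTheorem10 (k l : ℕ) (hk : 1 ≤ k) (hl : 1 ≤ l)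
    (u v : DoubleStarVertex k l)
    (hu : u = DoubleStarVertex.u k l) (hv : v = DoubleStarVertex.v k l) :
    (2 ≤ k → ∀ w ∈ (doubleStar k l).neighborSet u \ {v}, ∀ j : ZMod 2,
      ¬ InvolvedInPGST (blowUp 2 (doubleStar k l)) (j, w)) ∧
    (k = 1 →
      HasPGST (blowUp 2 (doubleStar k l)) (0, u) (1, u) ∧
      HasPGST (blowUp 2 (doubleStar k l)) (0, v) (1, v) ∧
      (∀ w ∈ (doubleStar k l).neighborSet u \ {v},
        HasPGST (blowUp 2 (doubleStar k l)) (0, w) (1, w)) ∧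
      (∀ x ∈ (doubleStar k l).neighborSet v \ {u},
        (HasPGST (blowUp 2 (doubleStar k l)) (0, x) (1, x) ↔ l = 1))) ∧
    (k = l →
      (HasPGST (blowUp 2 (doubleStar k l)) (0, u) (1, u) ↔ ¬ IsSquare (4 * k + 1))) ∧
    (k ≠ l →
      LinearIndepOn ℚ (fun x : ℝ => x) {x | x ∈ graphEigenvalues (doubleStar k l) ∧ 0 < x} →
      HasPGST (blowUp 2 (doubleStar k l)) (0, u) (1, u)) := by
  subst hu hv
  refine ⟨?_, ?_, ?_, ?_⟩
  · intro h2 w hw j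
    obtain ⟨i, rfl⟩ := mem_neighborSet_u_diff hw
    have : Nontrivial (Fin k) := Fin.nontrivial_iff_two_le.mpr h2
    obtain ⟨i', hi'⟩ := exists_ne i
    exact not_involvedInPGST_blowUp_of_twin (b := Sum.inl (some i')) (by simpa using hi')
      (adj_leaf_left_iff i i') j
  · rintro rfl
    have hD : ((l ^ 2 + 4 : ℕ) : ℝ) = ((1 : ℕ) - l) ^ 2 + 2 * ((1 : ℕ) + l) + 1 := by
      push_cast
      ring
    have hsq := not_isSquare_sq_add_four hl
    refine ⟨hasPGST_blowUp_doubleStar_of_not_isSquare hk hl hD hsq (single_u 1 l),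
      hasPGST_blowUp_doubleStar_of_not_isSquare hk hl hD hsq (single_v 1 l), ?_, ?_⟩
    · intro w hw
      obtain ⟨i, rfl⟩ := mem_neighborSet_u_diff hw
      exact hasPGST_blowUp_doubleStar_of_not_isSquare hk hl hD hsq (single_leaf_left l i)
    · intro x hx
      obtain ⟨j, rfl⟩ := mem_neighborSet_v_diff hx
      constructor
      · intro h
        by_contra hl1
        have : Nontrivial (Fin l) := Fin.nontrivial_iff_two_le.mpr (by omega)
        obtain ⟨j', hj'⟩ := exists_ne j
        exact not_involvedInPGST_blowUp_of_twin (b := Sum.inr (some j')) (by simpa using hj')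
          (adj_leaf_right_iff j j') 0 ⟨_, by simp, h⟩
      · rintro rfl
        exact hasPGST_blowUp_doubleStar_of_not_isSquare hk hl hD hsq (single_leaf_right 1 j)
  · rintro rfl
    refine ⟨fun h hsq => not_hasPGST_blowUp_doubleStar_u hk hsq h, fun hsq => ?_⟩
    exact hasPGST_blowUp_doubleStar_of_not_isSquare hk hk (by push_cast; ring) hsq (single_u k k)
  · intro _ hli
    exact hasPGST_blowUp_doubleStar_of_linearIndepOn hk hl hli (single_u k l)
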